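/- Let $m\ge 1$ be odd and $k\ge 0$, let $\mathbb R_{0,m}$ be the real Clifford algebra generated by the standard basis $e_1,\dots,e_m$ of $\mathbb R^m$ with $e_je_l+e_le_j=-2\delta_{jl}$, and identify $\underline x=(x_1,\dots,x_m)\in\mathbb R^m$ with $\sum_j x_je_j$. Let $\partial_{\underline x}=\sum_{j=1}^m e_j\partial_{x_j}$, $\Delta=\sum_{j=0}^m\partial_{x_j}^2$, $r=|\underline x|$, $\underline\omega=\underline x/r$, and put $N=k+\frac{m-1}{2}$. A $C^1$ function $F:\mathbb R^{m+1}\to\mathbb R_{0,m}$ (resp. $f:\mathbb R^m\to\mathbb R_{0,m}$) is called monogenic if $(\partial_{x_0}+\partial_{\underline x})F=0$ (resp. $\partial_{\underline x}f=0$). Let $P_k:\mathbb R^m\to\mathbb R_{0,m}$ be a homogeneous monogenic polynomial of degree $k$ (with coefficients in $\mathbb R_{0,m}$). Define $$\mathsf{CK}[g](x_0,\underline x)=\sum_{n=0}^\infty\frac{(-x_0)^n}{n!}\,\partial_{\underline x}^n g(\underline x),$$ $$\mathsf{Ft}[u+iv,P_k](x_0,\underline x)=\Delta^{N}\Bigl[\bigl(u(x_0,r)+\underline\omega\,v(x_0,r)\bigr)P_k(\underline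 x)\Bigr],$$ $D_r(j)[f]=(r^{-1}\partial_r)^jf$, $D^r(j)[f]=(\partial_r\,r^{-1})^jf$, and the Clifford–Hermite polynomials $H_{n,m}(P_k)=(2\underline x-\partial_{\underline x})^nP_k$. For $\mathsf{Ft}$ with $u+iv=\exp(z^2)$, the term $\underline\omega\,v(x_0,r)$ is taken to be $0$ at $\underline x=0$ (where $v(x_0,0)=0$). For $g(\underline x)=\exp(-|\underline x|^2)P_k(\underline x)$ the series $\mathsf{CK}[g]$ converges at every point of $\mathbb R^{m+1}$, its sum is monogenic in $\mathbb R^{m+1}$ and equals $g$ for $x_0=0$. Moreover, for all $(x_0,\underline x)\in\mathbb R^{m+1}$, $$\mathsf{CK}\bigl[\exp(-|\underline x|^2)P_k(\underline x)\bigr](x_0,\underline x)=\frac{\mathsf{Ft}\bigl[\exp(z^2),P_k\bigr](x_0,\underline x)}{(-2)^{k+\frac{m-1}{2}}\,(2k+m-1)!!},$$ and, for $\underline x\neq0$, this is equal to $$\exp(x_0^2-r^2)\left(\sum_{j=0}^{N}\binom{N}{j}(-2)^{-j}D_r(j)[\cos(2x_0r)]+\underline\omega\sum_{j=0}^{N}\binom{N}{j}(-2)^{-j}D^r(j)[\sin(2x_0r)]\right)P_k(\underline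 x);$$ as $(x_0',\underline x)\to(x_0,0)$ with $\underline x\ne0$, the last expression (taken at $(x_0',\underline x)$) tends to $\mathsf{CK}[g](x_0,0)$. Finally, $\mathsf{CK}[g]$ generates the Clifford–Hermite polynomials: for all $(x_0,\underline x)\in\mathbb R^{m+1}$, $$\mathsf{CK}[g](x_0,\underline x)=\exp(-|\underline x|^2)\sum_{n=0}^\infty\frac{x_0^n}{n!}\,H_{n,m}(P_k)(\underline x),$$ with a convergent series on the right. -/

import Mathlib

open scoped Nat Topology

noncomputable section

namespace CliffordAnalysis

/-- The Euclidean space `ℝ^m`. -/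
abbrev Vec (m : ℕ) : Type := EuclideanSpace ℝ (Fin m)

/-- The quadratic form `x ↦ -|x|²` on `ℝ^m`. -/
def negNormSq (m : ℕ) : QuadraticForm ℝ (Vec m) :=
  -LinearMap.BilinMap.toQuadraticMap (innerₗ (Vec m))

theorem negNormSq_apply {m : ℕ} (x : Vec m) : negNormSq m x = -‖x‖ ^ 2 := by
  simp [negNormSq]

/-- The real Clifford algebra `ℝ_{0,m}`: generated by `e₁, …, e_m` with
`e_j e_k + e_k e_j = -2 δ_{jk}`. -/
abbrev Cl (m : ℕ) : Type := CliffordAlgebra (negNormSq m)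

/-- A vector `x = ∑ x_j e_j` seen as an element of the Clifford algebra. -/
abbrev vec {m : ℕ} (x : Vec m) : Cl m := CliffordAlgebra.ι (negNormSq m) x

/-- The standard basis vector `e_j` of `ℝ^m`. -/
abbrev basisVec {m : ℕ} (j : Fin m) : Vec m := EuclideanSpace.single j (1 : ℝ)

theorem vec_mul_self {m : ℕ} (x : Vec m) :
    vec x * vec x = algebraMap ℝ (Cl m) (-‖x‖ ^ 2) := by
  rw [CliffordAlgebra.ι_sq_scalar, negNormSq_apply]

theorem basisVec_mul_add_swap {m : ℕ} (j l : Fin m) :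
    vec (basisVec j) * vec (basisVec l) + vec (basisVec l) * vec (basisVec j)
      = algebraMap ℝ (Cl m) (-2 * (if j = l then 1 else 0)) := by
  rw [CliffordAlgebra.ι_mul_ι_add_swap]
  congr 1
  by_cases h : j = l
  · subst h
    simp [negNormSq, QuadraticMap.polar, EuclideanSpace.inner_single_left]
    norm_num
  · have h' : ¬ l = j := fun e => h e.symm
    simp [negNormSq, QuadraticMap.polar, EuclideanSpace.inner_single_left, h, h']

/-- The `2^m` coordinates of an element of the Clifford algebra. -/
def coordEquiv (m : ℕ) : Cl m ≃ₗ[ℝ] EuclideanSpace ℝ (Finset (Fin m)) :=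
  letI : Invertible (2 : ℝ) := invertibleOfNonzero two_ne_zero
  ((CliffordAlgebra.equivExterior (negNormSq m)).trans
    ((EuclideanSpace.basisFun (Fin m) ℝ).toBasis.ExteriorAlgebra.equivFun)).trans
      (WithLp.linearEquiv 2 ℝ (Finset (Fin m) → ℝ)).symm

/-- The Euclidean norm of the coordinates. As the Clifford algebra is finite-dimensional, any
other norm would give the same limits, derivatives and infinite sums. -/
instance instNormedAddCommGroupCl (m : ℕ) : NormedAddCommGroup (Cl m) :=
  NormedAddCommGroup.induced (Cl m) (EuclideanSpace ℝ (Finset (Fin m)))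
    (coordEquiv m).toLinearMap (coordEquiv m).injective

instance instNormedSpaceCl (m : ℕ) : NormedSpace ℝ (Cl m) :=
  NormedSpace.induced ℝ (Cl m) (EuclideanSpace ℝ (Finset (Fin m))) (coordEquiv m).toLinearMap

instance instFiniteDimensionalCl (m : ℕ) : FiniteDimensional ℝ (Cl m) :=
  (coordEquiv m).symm.finiteDimensional

/-- The Dirac operator `∂_x f = ∑_j e_j ∂_{x_j} f` in `ℝ^m`. -/
def dirac {m : ℕ} (f : Vec m → Cl m) (x : Vec m) : Cl m :=
  ∑ j : Fin m, vec (basisVec j) * lineDeriv ℝ f x (basisVec j)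

/-- The partial derivative `∂_{x₀}` in `ℝ^{m+1} = ℝ × ℝ^m`. -/
def pd₀ {m : ℕ} (F : ℝ × Vec m → Cl m) (p : ℝ × Vec m) : Cl m :=
  lineDeriv ℝ F p (1, 0)

/-- The partial derivative `∂_{x_j}`, `1 ≤ j ≤ m`, in `ℝ^{m+1} = ℝ × ℝ^m`. -/
def pd {m : ℕ} (j : Fin m) (F : ℝ × Vec m → Cl m) (p : ℝ × Vec m) : Cl m :=
  lineDeriv ℝ F p (0, basisVec j)

/-- The generalized Cauchy–Riemann operator `∂_{x₀} + ∂_x` in `ℝ^{m+1}`. -/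
def cauchyRiemann {m : ℕ} (F : ℝ × Vec m → Cl m) (p : ℝ × Vec m) : Cl m :=
  pd₀ F p + ∑ j : Fin m, vec (basisVec j) * pd j F p

/-- The Laplacian `Δ = ∑_{j=0}^m ∂_{x_j}²` in `ℝ^{m+1}`. -/
def laplace {m : ℕ} (F : ℝ × Vec m → Cl m) (p : ℝ × Vec m) : Cl m :=
  pd₀ (pd₀ F) p + ∑ j : Fin m, pd j (pd j F) p

/-- Monogenic functions in `ℝ^m`. -/
def IsMonogenic {m : ℕ} (f : Vec m → Cl m) : Prop :=
  ContDiff ℝ 1 f ∧ ∀ x, dirac f x = 0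

/-- Monogenic functions in `ℝ^{m+1}`. -/
def IsMonogenicExt {m : ℕ} (F : ℝ × Vec m → Cl m) : Prop :=
  ContDiff ℝ 1 F ∧ ∀ p, cauchyRiemann F p = 0

/-- `P` is a homogeneous polynomial of degree `k` in `x₁, …, x_m` with coefficients in the
Clifford algebra. -/
def IsHomogeneousPolynomial {m : ℕ} (k : ℕ) (P : Vec m → Cl m) : Prop :=
  ∃ c : (Fin m → ℕ) → Cl m, ∀ x : Vec m,
    P x = ∑ a ∈ Finset.piAntidiag Finset.univ k, (∏ i, x i ^ a i) • c a

/-- The `n`-th term `((-x₀)^n / n!) ∂_x^n g(x)` of the Cauchy–Kowalevski series. -/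
def ckTerm {m : ℕ} (g : Vec m → Cl m) (p : ℝ × Vec m) (n : ℕ) : Cl m :=
  ((-p.1) ^ n / (n ! : ℝ)) • dirac^[n] g p.2

/-- The Cauchy–Kowalevski extension `CK[g](x₀, x) = ∑_n ((-x₀)^n / n!) ∂_x^n g(x)`. -/
def CK {m : ℕ} (g : Vec m → Cl m) (p : ℝ × Vec m) : Cl m :=
  ∑' n : ℕ, ckTerm g p n

/-- The unit vector `ω = x / |x|` (and `0` at `x = 0`). -/
def omega {m : ℕ} (x : Vec m) : Cl m := vec (‖x‖⁻¹ • x)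

/-- For `h = u + i v`, the function `(u(x₀, r) + ω v(x₀, r)) P(x)`, where `r = |x|`. -/
def fueterBase {m : ℕ} (h : ℂ → ℂ) (P : Vec m → Cl m) (p : ℝ × Vec m) : Cl m :=
  (algebraMap ℝ (Cl m) (h ⟨p.1, ‖p.2‖⟩).re + (h ⟨p.1, ‖p.2‖⟩).im • omega p.2) * P p.2

/-- `Ft[h(z), P_k] = Δ^{k + (m-1)/2} [(u(x₀, r) + ω v(x₀, r)) P_k(x)]` (for `m` odd). -/
def Ft {m : ℕ} (k : ℕ) (h : ℂ → ℂ) (P : Vec m → Cl m) : ℝ × Vec m → Cl m :=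
  laplace^[k + (m - 1) / 2] (fueterBase h P)

/-- `D_r(n)[u] = (r⁻¹ ∂_r)^n u`. -/
def lowerD (n : ℕ) (u : ℝ → ℝ) : ℝ → ℝ :=
  (fun f r => r⁻¹ * deriv f r)^[n] u

/-- `D^r(n)[v] = (∂_r r⁻¹)^n v`. -/
def upperD (n : ℕ) (v : ℝ → ℝ) : ℝ → ℝ :=
  (fun f => deriv (fun r => r⁻¹ * f r))^[n] v

/-- The operator `D_+ = 2 x - ∂_x`. -/
def Dplus {m : ℕ} (f : Vec m → Cl m) (x : Vec m) : Cl m :=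
  (2 : ℝ) • (vec x * f x) - dirac f x

/-- The Clifford–Hermite polynomial `H_{n,m}(P) = D_+^n P`. -/
def cliffordHermite {m : ℕ} (n : ℕ) (P : Vec m → Cl m) : Vec m → Cl m :=
  Dplus^[n] P

/-- `∑_{j=0}^N C(N,j) (-2)^{-j} D_r(j)[cos(2 x₀ r)]`. -/
def cosPart (N : ℕ) (x₀ r : ℝ) : ℝ :=
  ∑ j ∈ Finset.range (N + 1), (N.choose j : ℝ) * (-2 : ℝ) ^ (-(j : ℤ)) *
    lowerD j (fun s => Real.cos (2 * x₀ * s)) r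

/-- `∑_{j=0}^N C(N,j) (-2)^{-j} D^r(j)[sin(2 x₀ r)]`. -/
def sinPart (N : ℕ) (x₀ r : ℝ) : ℝ :=
  ∑ j ∈ Finset.range (N + 1), (N.choose j : ℝ) * (-2 : ℝ) ^ (-(j : ℤ)) *
    upperD j (fun s => Real.sin (2 * x₀ * s)) r

/-- The closed form `exp(x₀² - r²) (cosPart + ω sinPart) P(x)`, meaningful for `r = |x| > 0`. -/
def closedForm {m : ℕ} (N : ℕ) (P : Vec m → Cl m) (p : ℝ × Vec m) : Cl m :=
  Real.exp (p.1 ^ 2 - ‖p.2‖ ^ 2) •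
    ((algebraMap ℝ (Cl m) (cosPart N p.1 ‖p.2‖) + sinPart N p.1 ‖p.2‖ • omega p.2) * P p.2)

end CliffordAnalysis

end

/-!
A function `A(x₀, r²) P(x) + B(x₀, r²) x P(x)` of axial type is monogenic when `(A, B)` solves a
Vekua system in the variables `(t, s) = (x₀, r²)` whose index is `N = k + (m - 1) / 2`. The real
and imaginary parts of a holomorphic function solve the system of index `0`; differentiating in
`s` raises the index by one, and on axial functions built from a solution the Laplacian acts as a
multiple of `∂_s`. Hence `Δ ^ N` turns `(u + ω v) P` into a monogenic function (Fueter's theorem).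
The coefficients extend holomorphically to `ℂ²`, so this function is the sum of its Taylor series
in `x₀`, and by monogenicity that series is the Cauchy–Kowalevski series of its restriction to
`x₀ = 0`. For `exp (z ^ 2)` this restriction is a multiple of `exp (-|x|²) P(x)`. The closed form
is the Leibniz rule for `∂_s ^ N` applied to `exp (x₀² - s) cos (2 x₀ √s)` and
`exp (x₀² - s) sin (2 x₀ √s) / √s`, as `r⁻¹ ∂_r = 2 ∂_s`, and the Clifford–Hermite polynomials
appear because conjugation by `exp (-|x|²)` turns `∂_x` into `-(2 x - ∂_x)`.
-/

open scoped Nat Topology ContDiff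

noncomputable section

namespace CliffordAnalysis

section LineDeriv

variable {𝕜 E F : Type*} [NontriviallyNormedField 𝕜] [NormedAddCommGroup E] [NormedSpace 𝕜 E]
  [NormedAddCommGroup F] [NormedSpace 𝕜 F] {f g : E → F}

theorem contDiff_lineDeriv {n k : WithTop ℕ∞} (hf : ContDiff 𝕜 n f) (hkn : k + 1 ≤ n) (v : E) :
    ContDiff 𝕜 k fun x => lineDeriv 𝕜 f x v := by
  have hd : Differentiable 𝕜 f := (hf.of_le (le_add_self.trans hkn)).differentiable_one
  have h : (fun x => lineDeriv 𝕜 f x v) = fun x => fderiv 𝕜 f x v :=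
    funext fun x => (hd x).lineDeriv_eq_fderiv
  exact h ▸ (hf.fderiv_right hkn).clm_apply contDiff_const

theorem lineDeriv_const_smul (c : 𝕜) (f : E → F) (x v : E) :
    lineDeriv 𝕜 (fun y => c • f y) x v = c • lineDeriv 𝕜 f x v :=
  deriv_fun_const_smul_field c _

theorem lineDeriv_add {x : E} (hf : DifferentiableAt 𝕜 f x) (hg : DifferentiableAt 𝕜 g x)
    (v : E) :
    lineDeriv 𝕜 (fun y => f y + g y) x v = lineDeriv 𝕜 f x v + lineDeriv 𝕜 g x v := by
  rw [(hf.fun_add hg).lineDeriv_eq_fderiv, hf.lineDeriv_eq_fderiv, hg.lineDeriv_eq_fderiv,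
    fderiv_fun_add hf hg, add_apply]

theorem lineDeriv_comm {𝕜 E F : Type*} [RCLike 𝕜] [NormedAddCommGroup E] [NormedSpace 𝕜 E]
    [NormedAddCommGroup F] [NormedSpace 𝕜 F] {f : E → F} (hf : ContDiff 𝕜 2 f) (v w x : E) :
    lineDeriv 𝕜 (fun y => lineDeriv 𝕜 f y v) x w =
      lineDeriv 𝕜 (fun y => lineDeriv 𝕜 f y w) x v := by
  have second (v w : E) : lineDeriv 𝕜 (fun y => lineDeriv 𝕜 f y v) x w =
      fderiv 𝕜 (fderiv 𝕜 f) x w v := by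
    have hd : DifferentiableAt 𝕜 (fderiv 𝕜 f) x :=
      (hf.fderiv_right (m := 1) (by norm_num)).differentiable (by simp) x
    have h : HasFDerivAt (fun y => fderiv 𝕜 f y v) ((fderiv 𝕜 (fderiv 𝕜 f) x).flip v) x := by
      simpa using hd.hasFDerivAt.clm_apply (hasFDerivAt_const v x)
    rw [funext fun y => (hf.differentiable (by simp) y).lineDeriv_eq_fderiv (v := v),
      (h.hasLineDerivAt w).lineDeriv, ContinuousLinearMap.flip_apply]
  have symm : IsSymmSndFDerivAt 𝕜 f x := hf.contDiffAt.isSymmSndFDerivAt (by simp)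
  rw [second, second, symm.eq]

end LineDeriv

section Partials

variable {𝕜 : Type*} [RCLike 𝕜] {A B : 𝕜 × 𝕜 → 𝕜}

/-- The partial derivative of a function of two variables in the first one. -/
def partialFst (A : 𝕜 × 𝕜 → 𝕜) (p : 𝕜 × 𝕜) : 𝕜 := deriv (fun t => A (t, p.2)) p.1

/-- The partial derivative of a function of two variables in the second one. -/
def partialSnd (A : 𝕜 × 𝕜 → 𝕜) (p : 𝕜 × 𝕜) : 𝕜 := deriv (fun s => A (p.1, s)) p.2

theorem partialFst_eq_lineDeriv (A : 𝕜 × 𝕜 → 𝕜) :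
    partialFst A = fun p => lineDeriv 𝕜 A p (1, 0) := by
  funext ⟨t, s⟩
  simpa [partialFst, lineDeriv] using (deriv_comp_const_add (fun t => A (t, s)) t 0).symm

theorem partialSnd_eq_lineDeriv (A : 𝕜 × 𝕜 → 𝕜) :
    partialSnd A = fun p => lineDeriv 𝕜 A p (0, 1) := by
  funext ⟨t, s⟩
  simpa [partialSnd, lineDeriv] using (deriv_comp_const_add (fun s => A (t, s)) s 0).symm

theorem contDiff_partialFst (hA : ContDiff 𝕜 ∞ A) : ContDiff 𝕜 ∞ (partialFst A) :=
  partialFst_eq_lineDeriv A ▸ contDiff_lineDeriv hA (by simp) _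

theorem contDiff_partialSnd (hA : ContDiff 𝕜 ∞ A) : ContDiff 𝕜 ∞ (partialSnd A) :=
  partialSnd_eq_lineDeriv A ▸ contDiff_lineDeriv hA (by simp) _

theorem partialFst_partialSnd (hA : ContDiff 𝕜 2 A) :
    partialFst (partialSnd A) = partialSnd (partialFst A) := by
  simp only [partialFst_eq_lineDeriv, partialSnd_eq_lineDeriv]
  exact funext fun p => lineDeriv_comm hA _ _ p

theorem partialFst_const_mul (c : 𝕜) (A : 𝕜 × 𝕜 → 𝕜) :
    partialFst (fun p => c * A p) = fun p => c * partialFst A p :=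
  funext fun _ => deriv_const_mul_field c

theorem partialSnd_const_mul (c : 𝕜) (A : 𝕜 × 𝕜 → 𝕜) :
    partialSnd (fun p => c * A p) = fun p => c * partialSnd A p :=
  funext fun _ => deriv_const_mul_field c

theorem hasDerivAt_partialFst (hA : Differentiable 𝕜 A) (t s : 𝕜) :
    HasDerivAt (fun t => A (t, s)) (partialFst A (t, s)) t :=
  (show DifferentiableAt 𝕜 (fun t => A (t, s)) t by fun_prop).hasDerivAt

theorem hasDerivAt_partialSnd (hA : Differentiable 𝕜 A) (t s : 𝕜) :
    HasDerivAt (fun s => A (t, s)) (partialSnd A (t, s)) s :=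
  (show DifferentiableAt 𝕜 (fun s => A (t, s)) s by fun_prop).hasDerivAt

theorem iterate_partialFst (A : 𝕜 × 𝕜 → 𝕜) (n : ℕ) (t s : 𝕜) :
    partialFst^[n] A (t, s) = iteratedDeriv n (fun t => A (t, s)) t := by
  induction n generalizing t with
  | zero => simp
  | succ n ih =>
    simp only [Function.iterate_succ_apply', iteratedDeriv_succ, ← funext ih, partialFst]

theorem iterate_partialSnd (A : 𝕜 × 𝕜 → 𝕜) (n : ℕ) (t s : 𝕜) :
    partialSnd^[n] A (t, s) = iteratedDeriv n (fun s => A (t, s)) s := by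
  induction n generalizing s with
  | zero => simp
  | succ n ih =>
    simp only [Function.iterate_succ_apply', iteratedDeriv_succ, ← funext ih, partialSnd]

/-- The system `∂ₜ A = (2 n + 1) B + 2 s ∂ₛ B`, `∂ₜ B = -2 ∂ₛ A` in the variables `(t, s)`. It says
that `(A(x₀, |x|²) + x B(x₀, |x|²)) P(x)` is annihilated by the Cauchy–Riemann operator whenever
`P` is a homogeneous monogenic polynomial of degree `k` with `m + 2 k = 2 n + 1`. -/
structure IsVekuaPair (n : ℕ) (A B : 𝕜 × 𝕜 → 𝕜) : Prop where
  contDiff_left : ContDiff 𝕜 ∞ A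
  contDiff_right : ContDiff 𝕜 ∞ B
  partialFst_left : ∀ p, partialFst A p = (2 * n + 1) * B p + 2 * p.2 * partialSnd B p
  partialFst_right : ∀ p, partialFst B p = -2 * partialSnd A p

theorem partialSnd_vekuaLeft (hB : ContDiff 𝕜 ∞ B) (n : ℕ) (p : 𝕜 × 𝕜) :
    partialSnd (fun q => (2 * n + 1) * B q + 2 * q.2 * partialSnd B q) p =
      (2 * n + 3) * partialSnd B p + 2 * p.2 * partialSnd (partialSnd B) p := by
  have hB₀ := hasDerivAt_partialSnd (hB.differentiable (by simp)) p.1 p.2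
  have hB₁ := hasDerivAt_partialSnd
    ((contDiff_partialSnd hB).differentiable (by simp)) p.1 p.2
  have h := (hB₀.const_mul (2 * n + 1 : 𝕜)).add (((hasDerivAt_id p.2).const_mul 2).mul hB₁)
  refine h.deriv.trans ?_
  simp only [id, Prod.mk.eta]
  ring

namespace IsVekuaPair

variable {n : ℕ}

theorem partialFst_partialFst_right (h : IsVekuaPair n A B) (p : 𝕜 × 𝕜) :
    partialFst (partialFst B) p =
      -2 * ((2 * n + 3) * partialSnd B p + 2 * p.2 * partialSnd (partialSnd B) p) := by
  rw [funext h.partialFst_right, partialFst_const_mul,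
    partialFst_partialSnd (contDiff_infty.1 h.contDiff_left 2), funext h.partialFst_left]
  exact congrArg (-2 * ·) (partialSnd_vekuaLeft h.contDiff_right n p)

theorem partialFst_partialFst_left (h : IsVekuaPair n A B) (p : 𝕜 × 𝕜) :
    partialFst (partialFst A) p =
      -2 * ((2 * n + 1) * partialSnd A p + 2 * p.2 * partialSnd (partialSnd A) p) := by
  have hB₀ := hasDerivAt_partialFst (h.contDiff_right.differentiable (by simp)) p.1 p.2
  have hB₁ := hasDerivAt_partialFst
    ((contDiff_partialSnd h.contDiff_right).differentiable (by simp)) p.1 p.2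
  have hd := (hB₀.const_mul (2 * n + 1 : 𝕜)).add (hB₁.const_mul (2 * p.2))
  rw [funext h.partialFst_left]
  refine hd.deriv.trans ?_
  rw [partialFst_partialSnd (contDiff_infty.1 h.contDiff_right 2), funext h.partialFst_right,
    partialSnd_const_mul]
  simp only [Prod.mk.eta]
  ring

protected theorem partialSnd (h : IsVekuaPair n A B) :
    IsVekuaPair (n + 1) (partialSnd A) (partialSnd B) where
  contDiff_left := contDiff_partialSnd h.contDiff_left
  contDiff_right := contDiff_partialSnd h.contDiff_right
  partialFst_left p := by
    rw [partialFst_partialSnd (contDiff_infty.1 h.contDiff_left 2), funext h.partialFst_left,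
      partialSnd_vekuaLeft h.contDiff_right]
    push_cast
    ring
  partialFst_right p := by
    rw [partialFst_partialSnd (contDiff_infty.1 h.contDiff_right 2), funext h.partialFst_right,
      partialSnd_const_mul]

theorem iterate_partialSnd (h : IsVekuaPair n A B) (j : ℕ) :
    IsVekuaPair (n + j) (partialSnd^[j] A) (partialSnd^[j] B) := by
  induction j with
  | zero => exact h
  | succ j ih => simpa only [Function.iterate_succ_apply', ← add_assoc] using ih.partialSnd

end IsVekuaPair

end Partials

section RealPart

variable {A B : ℂ × ℂ → ℂ} {n : ℕ}

/-- The even and the odd part in `w` of `h (z + i w)`, in the form of smooth functions of `z` and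
`w ^ 2`. They exist for every entire function `h`. -/
structure IsStemPair (h : ℂ → ℂ) (A B : ℂ × ℂ → ℂ) : Prop where
  contDiff_left : ContDiff ℂ ∞ A
  contDiff_right : ContDiff ℂ ∞ B
  add_mul_eq : ∀ z w, A (z, w ^ 2) + Complex.I * w * B (z, w ^ 2) = h (z + Complex.I * w)

namespace IsStemPair

variable {h : ℂ → ℂ}

protected theorem differentiable (hAB : IsStemPair h A B) : Differentiable ℂ h := by
  have heq : h = fun z => A (z, 0) := funext fun z => by simpa using (hAB.add_mul_eq z 0).symm
  exact heq ▸ (hAB.contDiff_left.differentiable (by simp)).comp (by fun_prop)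

theorem cauchyRiemann_eq (hAB : IsStemPair h A B) (z w : ℂ) :
    (partialFst A (z, w ^ 2) - (B (z, w ^ 2) + 2 * w ^ 2 * partialSnd B (z, w ^ 2))) +
      Complex.I * w * (partialFst B (z, w ^ 2) + 2 * partialSnd A (z, w ^ 2)) = 0 := by
  have hA : Differentiable ℂ A := hAB.contDiff_left.differentiable (by simp)
  have hB : Differentiable ℂ B := hAB.contDiff_right.differentiable (by simp)
  have hh : Differentiable ℂ h := hAB.differentiable
  have deriv_z : partialFst A (z, w ^ 2) + Complex.I * w * partialFst B (z, w ^ 2) =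
      deriv h (z + Complex.I * w) := by
    have hl := (hasDerivAt_partialFst hA z (w ^ 2)).add
      ((hasDerivAt_partialFst hB z (w ^ 2)).const_mul (Complex.I * w))
    have hr := (hh (z + Complex.I * w)).hasDerivAt.comp_add_const z (Complex.I * w)
    exact hl.unique (hr.congr_of_eventuallyEq (.of_forall fun z => hAB.add_mul_eq z w))
  have deriv_w : partialSnd A (z, w ^ 2) * (2 * w) + Complex.I * (B (z, w ^ 2) +
      w * (partialSnd B (z, w ^ 2) * (2 * w))) = deriv h (z + Complex.I * w) * Complex.I := by
    have hsq : HasDerivAt (fun w : ℂ => w ^ 2) (2 * w) w := by simpa using hasDerivAt_pow 2 w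
    have hl := ((hasDerivAt_partialSnd hA z (w ^ 2)).comp w hsq).add
      (((hasDerivAt_id w).mul ((hasDerivAt_partialSnd hB z (w ^ 2)).comp w hsq)).const_mul
        Complex.I)
    have hr := (hh (z + Complex.I * w)).hasDerivAt.comp w
      (((hasDerivAt_id w).const_mul Complex.I).const_add z)
    have hu := hl.unique (hr.congr_of_eventuallyEq (.of_forall fun w => by
      simp [← hAB.add_mul_eq z w, mul_assoc]))
    simpa using hu
  linear_combination deriv_z + Complex.I * deriv_w +
    (deriv h (z + Complex.I * w) - B (z, w ^ 2) - 2 * w ^ 2 * partialSnd B (z, w ^ 2)) *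
      Complex.I_sq

protected theorem isVekuaPair (hAB : IsStemPair h A B) : IsVekuaPair 0 A B := by
  -- The even and odd parts in `w` of the Cauchy–Riemann equation form the Vekua system.
  have eq (z w : ℂ) := hAB.cauchyRiemann_eq z w
  have eq_neg (z w : ℂ) := neg_sq w ▸ eq z (-w)
  refine ⟨hAB.contDiff_left, hAB.contDiff_right, fun ⟨z, s⟩ => ?_, fun ⟨z, s⟩ => ?_⟩
  · obtain ⟨w, rfl⟩ := IsAlgClosed.exists_pow_nat_eq s two_pos
    push_cast
    linear_combination (eq z w + eq_neg z w) / 2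
  · have continuous_slice {C : ℂ × ℂ → ℂ} (hC : ContDiff ℂ ∞ C) : Continuous fun s => C (z, s) :=
      hC.continuous.comp (by fun_prop)
    refine congrFun ((continuous_slice (contDiff_partialFst hAB.contDiff_right)).ext_on
      (dense_compl_singleton 0)
      ((continuous_slice (contDiff_partialSnd hAB.contDiff_left)).const_mul (-2))
      fun s hs => ?_) s
    obtain ⟨w, rfl⟩ := IsAlgClosed.exists_pow_nat_eq s two_pos
    have hw : w ≠ 0 := by simpa using hs
    refine mul_left_cancel₀ (mul_ne_zero Complex.I_ne_zero hw) ?_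
    linear_combination (eq z w - eq_neg z w) / 2

end IsStemPair

/-- The real part of a function of two complex variables, restricted to real arguments. -/
def reRestrict (A : ℂ × ℂ → ℂ) (p : ℝ × ℝ) : ℝ := (A (p.1, p.2)).re

theorem contDiff_reRestrict (hA : ContDiff ℂ ∞ A) : ContDiff ℝ ∞ (reRestrict A) :=
  Complex.reCLM.contDiff.comp ((hA.restrict_scalars ℝ).comp
    ((Complex.ofRealCLM.contDiff.comp contDiff_fst).prodMk
      (Complex.ofRealCLM.contDiff.comp contDiff_snd)))

theorem partialFst_reRestrict (hA : Differentiable ℂ A) :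
    partialFst (reRestrict A) = reRestrict (partialFst A) :=
  funext fun p => (hasDerivAt_partialFst hA p.1 p.2).real_of_complex.deriv

theorem partialSnd_reRestrict (hA : Differentiable ℂ A) :
    partialSnd (reRestrict A) = reRestrict (partialSnd A) :=
  funext fun p => (hasDerivAt_partialSnd hA p.1 p.2).real_of_complex.deriv

theorem iterate_partialFst_reRestrict (hA : ContDiff ℂ ∞ A) (n : ℕ) :
    partialFst^[n] (reRestrict A) = reRestrict (partialFst^[n] A) := by
  induction n generalizing A with
  | zero => rfl
  | succ n ih =>
    rw [Function.iterate_succ_apply, Function.iterate_succ_apply,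
      partialFst_reRestrict (hA.differentiable (by simp)), ih (contDiff_partialFst hA)]

theorem iterate_partialSnd_reRestrict (hA : ContDiff ℂ ∞ A) (n : ℕ) :
    partialSnd^[n] (reRestrict A) = reRestrict (partialSnd^[n] A) := by
  induction n generalizing A with
  | zero => rfl
  | succ n ih =>
    rw [Function.iterate_succ_apply, Function.iterate_succ_apply,
      partialSnd_reRestrict (hA.differentiable (by simp)), ih (contDiff_partialSnd hA)]

theorem IsVekuaPair.reRestrict (h : IsVekuaPair n A B) :
    IsVekuaPair n (reRestrict A) (reRestrict B) where
  contDiff_left := contDiff_reRestrict h.contDiff_left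
  contDiff_right := contDiff_reRestrict h.contDiff_right
  partialFst_left p := by
    rw [partialFst_reRestrict (h.contDiff_left.differentiable (by simp)),
      partialSnd_reRestrict (h.contDiff_right.differentiable (by simp))]
    simp [CliffordAnalysis.reRestrict, h.partialFst_left]
  partialFst_right p := by
    rw [partialFst_reRestrict (h.contDiff_right.differentiable (by simp)),
      partialSnd_reRestrict (h.contDiff_left.differentiable (by simp))]
    simp [CliffordAnalysis.reRestrict, h.partialFst_right]

theorem hasSum_iterate_partialFst_reRestrict (hA : ContDiff ℂ ∞ A) (t s : ℝ) :
    HasSum (fun n : ℕ => t ^ n / n ! * partialFst^[n] (reRestrict A) (0, s))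
      (reRestrict A (t, s)) := by
  have hd : Differentiable ℂ fun z => A (z, s) := fun z =>
    (hasDerivAt_partialFst (hA.differentiable (by simp)) z s).differentiableAt
  refine (Complex.reCLM.hasSum (Complex.hasSum_taylorSeries_of_entire hd 0 t)).congr_fun fun n => ?_
  rw [iterate_partialFst_reRestrict hA, ← iterate_partialFst]
  have hcoeff : (n ! : ℂ)⁻¹ * (t : ℂ) ^ n = (t ^ n / n ! : ℝ) := by
    push_cast
    ring
  simp only [reRestrict, sub_zero, smul_eq_mul, Complex.reCLM_apply, ← mul_assoc, hcoeff,
    Complex.re_ofReal_mul, Complex.ofReal_zero]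

end RealPart

section Clifford

variable {m : ℕ}

/-- The multiplication of the Clifford algebra as a continuous bilinear map. -/
def clMul (m : ℕ) : Cl m →L[ℝ] Cl m →L[ℝ] Cl m :=
  (LinearMap.mul ℝ (Cl m)).toContinuousBilinearMap

/-- The embedding of vectors into the Clifford algebra as a continuous linear map. -/
def vecL (m : ℕ) : Vec m →L[ℝ] Cl m :=
  (CliffordAlgebra.ι (negNormSq m)).toContinuousLinearMap

theorem clMul_apply (a b : Cl m) : clMul m a b = a * b := rfl

theorem vecL_apply (x : Vec m) : vecL m x = vec x := rfl

theorem sum_smul_basisVec (x : Vec m) : ∑ j, x j • (basisVec j : Vec m) = x := by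
  ext i
  simp [Finset.sum_apply, Pi.single_apply]

theorem sum_smul_vec_basisVec (x : Vec m) : ∑ j, x j • vec (basisVec j) = vec x := by
  conv_rhs => rw [← sum_smul_basisVec x]
  simp only [vec, map_sum, map_smul]

theorem basisVec_mul_self (j : Fin m) : vec (basisVec j : Vec m) * vec (basisVec j) = -1 := by
  rw [vec_mul_self]
  simp

theorem basisVec_mul_vec (j : Fin m) (x : Vec m) :
    vec (basisVec j) * vec x = -(vec x * vec (basisVec j)) - (2 * x j) • (1 : Cl m) := by
  have hpolar : QuadraticMap.polar (negNormSq m) (basisVec j) x = -(2 * x j) := by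
    simp only [QuadraticMap.polar, negNormSq_apply, norm_add_sq_real]
    simp [EuclideanSpace.inner_single_left]
    ring
  have h := CliffordAlgebra.ι_mul_ι_add_swap (Q := negNormSq m) (basisVec j) x
  rw [hpolar, Algebra.algebraMap_eq_smul_one, neg_smul] at h
  rw [← sub_eq_iff_eq_add'.2 h.symm]
  abel

theorem vec_mul_vec_mul (x : Vec m) (a : Cl m) : vec x * (vec x * a) = -(‖x‖ ^ 2 • a) := by
  rw [← mul_assoc, vec_mul_self, Algebra.algebraMap_eq_smul_one, smul_mul_assoc, one_mul, neg_smul]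

theorem sum_sum_basisVec_mul (S : Fin m → Fin m → Cl m) (hS : ∀ i j, S i j = S j i) :
    ∑ i, ∑ j, vec (basisVec i) * (vec (basisVec j) * S i j) = -∑ j, S j j := by
  have hswap : ∑ i, ∑ j, vec (basisVec i) * (vec (basisVec j) * S i j) =
      ∑ i, ∑ j, vec (basisVec j) * (vec (basisVec i) * S i j) := by
    rw [Finset.sum_comm]
    simp only [hS]
  have hadd : ∑ i, ∑ j, vec (basisVec i) * (vec (basisVec j) * S i j) +
      ∑ i, ∑ j, vec (basisVec j) * (vec (basisVec i) * S i j) = (-2 : ℝ) • ∑ j, S j j := by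
    simp only [← Finset.sum_add_distrib, ← mul_assoc, ← add_mul, basisVec_mul_add_swap]
    simp [Algebra.algebraMap_eq_smul_one, Finset.smul_sum]
  rw [← hswap, ← two_smul ℝ, neg_smul, ← smul_neg] at hadd
  exact smul_right_injective _ two_ne_zero hadd

theorem norm_smul_omega (x : Vec m) : ‖x‖ • omega x = vec x := by
  rcases eq_or_ne x 0 with rfl | hx
  · simp
  · rw [omega, vec, ← map_smul, smul_inv_smul₀ (norm_ne_zero_iff.2 hx)]

end Clifford

section Dirac

variable {m : ℕ} {f g : Vec m → Cl m} {x : Vec m}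

theorem lineDeriv_sum_basisVec_mul {E : Type*} [NormedAddCommGroup E] [NormedSpace ℝ E]
    {g : Fin m → E → Cl m} {x : E} (hg : ∀ j, DifferentiableAt ℝ (g j) x) (v : E) :
    lineDeriv ℝ (fun y => ∑ j, vec (basisVec j) * g j y) x v =
      ∑ j, vec (basisVec j) * lineDeriv ℝ (g j) x v := by
  have h : HasFDerivAt (fun y => ∑ j, vec (basisVec j) * g j y)
      (∑ j, (clMul m (vec (basisVec j))).comp (fderiv ℝ (g j) x)) x :=
    HasFDerivAt.fun_sum fun j _ =>
      (clMul m (vec (basisVec j))).hasFDerivAt.comp x (hg j).hasFDerivAt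
  rw [(h.hasLineDerivAt v).lineDeriv, sum_apply]
  exact Finset.sum_congr rfl fun j _ => by rw [(hg j).lineDeriv_eq_fderiv]; rfl

theorem contDiff_vec_mul (hf : ContDiff ℝ ∞ f) : ContDiff ℝ ∞ fun x => vec x * f x :=
  ((clMul m).contDiff.comp (vecL m).contDiff).clm_apply hf

theorem contDiff_dirac (hf : ContDiff ℝ ∞ f) : ContDiff ℝ ∞ (dirac f) :=
  ContDiff.sum fun j _ =>
    (clMul m (vec (basisVec j))).contDiff.comp (contDiff_lineDeriv hf (by simp) _)

theorem contDiff_Dplus (hf : ContDiff ℝ ∞ f) : ContDiff ℝ ∞ (Dplus f) :=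
  ((contDiff_vec_mul hf).const_smul (2 : ℝ)).sub (contDiff_dirac hf)

theorem dirac_eq_sum_fderiv (hf : DifferentiableAt ℝ f x) :
    dirac f x = ∑ j, vec (basisVec j) * fderiv ℝ f x (basisVec j) := by
  simp only [dirac, hf.lineDeriv_eq_fderiv]

theorem dirac_add (hf : DifferentiableAt ℝ f x) (hg : DifferentiableAt ℝ g x) :
    dirac (fun y => f y + g y) x = dirac f x + dirac g x := by
  simp only [dirac, lineDeriv_add hf hg, mul_add, Finset.sum_add_distrib]

theorem dirac_const_smul (c : ℝ) (f : Vec m → Cl m) :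
    dirac (fun y => c • f y) = fun x => c • dirac f x := by
  funext x
  simp only [dirac, lineDeriv_const_smul, mul_smul_comm, Finset.smul_sum]

theorem iterate_dirac_const_smul (c : ℝ) (f : Vec m → Cl m) (n : ℕ) :
    dirac^[n] (fun y => c • f y) = fun x => c • dirac^[n] f x := by
  induction n generalizing f with
  | zero => rfl
  | succ n ih => simp only [Function.iterate_succ_apply, dirac_const_smul, ih]

theorem dirac_radial_smul {a : ℝ → ℝ} {a' : ℝ} (ha : HasDerivAt a a' (‖x‖ ^ 2))
    (hf : DifferentiableAt ℝ f x) :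
    dirac (fun y => a (‖y‖ ^ 2) • f y) x =
      (2 * a') • (vec x * f x) + a (‖x‖ ^ 2) • dirac f x := by
  have hradial : HasFDerivAt (fun y : Vec m => a (‖y‖ ^ 2)) (a' • (2 • innerSL ℝ x)) x :=
    ha.comp_hasFDerivAt x (hasStrictFDerivAt_norm_sq x).hasFDerivAt
  have hprod : HasFDerivAt (fun y => a (‖y‖ ^ 2) • f y) _ x := hradial.smul hf.hasFDerivAt
  rw [dirac_eq_sum_fderiv hprod.differentiableAt, dirac_eq_sum_fderiv hf, hprod.fderiv,
    ← sum_smul_vec_basisVec x, Finset.sum_mul, Finset.smul_sum, Finset.smul_sum,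
    ← Finset.sum_add_distrib]
  refine Finset.sum_congr rfl fun j _ => ?_
  have hinner : inner ℝ x (basisVec j) = x j := by simp [EuclideanSpace.inner_single_right]
  simp only [add_apply, smul_apply, ContinuousLinearMap.smulRight_apply, innerSL_apply_apply,
    hinner, mul_add, mul_smul_comm, smul_mul_assoc, smul_eq_mul, nsmul_eq_mul]
  module

theorem dirac_vec_mul (hf : DifferentiableAt ℝ f x) :
    dirac (fun y => vec y * f y) x =
      -((m : ℝ) • f x) - (2 : ℝ) • fderiv ℝ f x x - vec x * dirac f x := by
  have hprod : HasFDerivAt (fun y => vec y * f y) ((clMul m (vecL m x)).comp (fderiv ℝ f x) +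
      ((clMul m).comp (vecL m)).flip (f x)) x :=
    ((clMul m).comp (vecL m)).hasFDerivAt.clm_apply hf.hasFDerivAt
  have hterm (j : Fin m) : vec (basisVec j) * ((clMul m (vecL m x)).comp (fderiv ℝ f x) +
      ((clMul m).comp (vecL m)).flip (f x)) (basisVec j) =
        -(vec x * (vec (basisVec j) * fderiv ℝ f x (basisVec j))) -
          (2 : ℝ) • fderiv ℝ f x (x j • basisVec j) - f x := by
    simp only [add_apply, ContinuousLinearMap.comp_apply,
      ContinuousLinearMap.flip_apply, clMul_apply, vecL_apply, mul_add, map_smul]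
    rw [← mul_assoc, ← mul_assoc (vec (basisVec j)), basisVec_mul_self, basisVec_mul_vec, sub_mul,
      neg_mul, mul_assoc, smul_mul_assoc, one_mul, neg_one_mul, mul_smul]
    abel
  rw [dirac_eq_sum_fderiv hprod.differentiableAt, dirac_eq_sum_fderiv hf, hprod.fderiv]
  simp only [hterm, Finset.sum_sub_distrib, Finset.sum_neg_distrib, ← Finset.mul_sum,
    ← Finset.smul_sum, ← map_sum, sum_smul_basisVec, Finset.sum_const, Finset.card_univ,
    Fintype.card_fin, Nat.cast_smul_eq_nsmul]
  abel

theorem dirac_dirac (hf : ContDiff ℝ 2 f) (x : Vec m) :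
    dirac (dirac f) x =
      -∑ j, lineDeriv ℝ (fun y => lineDeriv ℝ f y (basisVec j)) x (basisVec j) := by
  have hd (j : Fin m) : DifferentiableAt ℝ (fun y => lineDeriv ℝ f y (basisVec j)) x :=
    (contDiff_lineDeriv hf (k := 1) (by norm_num) _).differentiable_one x
  have h : dirac (dirac f) x = ∑ i, ∑ j, vec (basisVec i) * (vec (basisVec j) *
      lineDeriv ℝ (fun y => lineDeriv ℝ f y (basisVec j)) x (basisVec i)) := by
    simp only [← Finset.mul_sum, ← lineDeriv_sum_basisVec_mul hd]
    rfl
  rw [h, sum_sum_basisVec_mul _ fun i j => lineDeriv_comm hf _ _ x]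

theorem dirac_exp_neg_norm_sq_smul (hf : Differentiable ℝ f) :
    dirac (fun x => Real.exp (-‖x‖ ^ 2) • f x) =
      fun x => (-1 : ℝ) • Real.exp (-‖x‖ ^ 2) • Dplus f x := by
  funext x
  have hexp : HasDerivAt (fun s : ℝ => Real.exp (-s)) (Real.exp (-‖x‖ ^ 2) * -1) (‖x‖ ^ 2) :=
    (hasDerivAt_id (‖x‖ ^ 2)).neg.exp
  rw [dirac_radial_smul hexp (hf x), Dplus]
  module

theorem iterate_dirac_exp_neg_norm_sq_smul (hf : ContDiff ℝ ∞ f) (n : ℕ) :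
    dirac^[n] (fun x => Real.exp (-‖x‖ ^ 2) • f x) =
      fun x => (-1 : ℝ) ^ n • Real.exp (-‖x‖ ^ 2) • cliffordHermite n f x := by
  induction n generalizing f with
  | zero => simp [cliffordHermite]
  | succ n ih =>
    rw [Function.iterate_succ_apply, dirac_exp_neg_norm_sq_smul (hf.differentiable (by simp)),
      iterate_dirac_const_smul, ih (contDiff_Dplus hf)]
    simp only [smul_smul, pow_succ', mul_assoc, cliffordHermite, Function.iterate_succ_apply]

theorem ckTerm_exp_neg_norm_sq_smul (hf : ContDiff ℝ ∞ f) (p : ℝ × Vec m) (n : ℕ) :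
    ckTerm (fun x => Real.exp (-‖x‖ ^ 2) • f x) p n =
      (Real.exp (-‖p.2‖ ^ 2) * (p.1 ^ n / n !)) • cliffordHermite n f p.2 := by
  have hsign : (-p.1) ^ n * (-1) ^ n = p.1 ^ n := by rw [← mul_pow, mul_neg_one, neg_neg]
  rw [ckTerm, iterate_dirac_exp_neg_norm_sq_smul hf, smul_smul, smul_smul, ← hsign]
  congr 1
  ring

end Dirac

section HomogeneousPolynomial

variable {m k : ℕ} {P : Vec m → Cl m}

theorem IsHomogeneousPolynomial.contDiff (hP : IsHomogeneousPolynomial k P) :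
    ContDiff ℝ ∞ P := by
  obtain ⟨c, hc⟩ := hP
  rw [funext hc]
  exact ContDiff.sum fun a _ =>
    (show ContDiff ℝ ∞ fun x : Vec m => ∏ i, x i ^ a i by fun_prop).smul contDiff_const

theorem IsHomogeneousPolynomial.map_smul (hP : IsHomogeneousPolynomial k P) (t : ℝ) (x : Vec m) :
    P (t • x) = t ^ k • P x := by
  obtain ⟨c, hc⟩ := hP
  rw [hc, hc, Finset.smul_sum]
  refine Finset.sum_congr rfl fun a ha => ?_
  have hdeg : ∑ i, a i = k := (Finset.mem_piAntidiag.1 ha).1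
  simp only [PiLp.smul_apply, smul_eq_mul, mul_pow, Finset.prod_mul_distrib,
    Finset.prod_pow_eq_pow_sum, hdeg, smul_smul]

theorem fderiv_self_of_map_smul {E F : Type*} [NormedAddCommGroup E] [NormedSpace ℝ E]
    [NormedAddCommGroup F] [NormedSpace ℝ F] {f : E → F} {x : E}
    (hf : DifferentiableAt ℝ f x) (hk : ∀ t : ℝ, f (t • x) = t ^ k • f x) :
    fderiv ℝ f x x = (k : ℝ) • f x := by
  have hray : HasDerivAt (fun t : ℝ => t • x) x 1 := by
    simpa using (hasDerivAt_id (1 : ℝ)).smul_const x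
  have hchain : HasDerivAt (fun t : ℝ => f (t • x)) (fderiv ℝ f x x) 1 :=
    HasFDerivAt.comp_hasDerivAt (1 : ℝ) (by simpa using hf.hasFDerivAt) hray
  have hpow : HasDerivAt (fun t : ℝ => t ^ k • f x) ((k : ℝ) • f x) 1 := by
    simpa using (hasDerivAt_pow k (1 : ℝ)).smul_const (f x)
  exact hchain.unique (hpow.congr_of_eventuallyEq (.of_forall hk))

end HomogeneousPolynomial

section CauchyRiemann

variable {m : ℕ} {F : ℝ × Vec m → Cl m}

theorem lineDeriv_slice (F : ℝ × Vec m → Cl m) (t : ℝ) (x v : Vec m) :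
    lineDeriv ℝ (fun y => F (t, y)) x v = lineDeriv ℝ F (t, x) (0, v) := by
  simp [lineDeriv]

theorem contDiff_slice {n : WithTop ℕ∞} (hF : ContDiff ℝ n F) (t : ℝ) :
    ContDiff ℝ n fun x => F (t, x) :=
  hF.comp (contDiff_const.prodMk contDiff_id)

theorem contDiff_pd₀ (hF : ContDiff ℝ ∞ F) : ContDiff ℝ ∞ (pd₀ F) :=
  contDiff_lineDeriv hF (by simp) _

theorem cauchyRiemann_eq_pd₀_add_dirac (F : ℝ × Vec m → Cl m) (t : ℝ) (x : Vec m) :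
    cauchyRiemann F (t, x) = pd₀ F (t, x) + dirac (fun y => F (t, y)) x := by
  simp only [cauchyRiemann, pd, dirac, lineDeriv_slice]

theorem laplace_eq_pd₀_pd₀_sub_dirac_dirac (hF : ContDiff ℝ 2 F) (t : ℝ) (x : Vec m) :
    laplace F (t, x) = pd₀ (pd₀ F) (t, x) - dirac (dirac fun y => F (t, y)) x := by
  have hpd (j : Fin m) : pd j (pd j F) (t, x) =
      lineDeriv ℝ (fun y => lineDeriv ℝ (fun y => F (t, y)) y (basisVec j)) x (basisVec j) := by
    simp only [lineDeriv_slice F]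
    exact (lineDeriv_slice (pd j F) t x _).symm
  rw [dirac_dirac (contDiff_slice hF t), sub_neg_eq_add, laplace]
  simp only [hpd]

theorem laplace_const_smul (c : ℝ) (F : ℝ × Vec m → Cl m) :
    laplace (fun p => c • F p) = fun p => c • laplace F p := by
  funext p
  have hpd₀ (G : ℝ × Vec m → Cl m) : pd₀ (fun p => c • G p) = fun p => c • pd₀ G p :=
    funext fun p => lineDeriv_const_smul c G p _
  have hpd (j : Fin m) (G : ℝ × Vec m → Cl m) :
      pd j (fun p => c • G p) = fun p => c • pd j G p :=
    funext fun p => lineDeriv_const_smul c G p _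
  simp only [laplace, hpd₀, hpd, smul_add, Finset.smul_sum]

theorem IsMonogenicExt.const_smul (hF : IsMonogenicExt F) (c : ℝ) :
    IsMonogenicExt fun p => c • F p := by
  refine ⟨hF.1.const_smul c, fun p => ?_⟩
  have hCR : cauchyRiemann (fun p => c • F p) p = c • cauchyRiemann F p := by
    simp only [cauchyRiemann, pd₀, pd, lineDeriv_const_smul, smul_add, mul_smul_comm,
      Finset.smul_sum]
  rw [hCR, hF.2, smul_zero]

theorem cauchyRiemann_pd₀ (hF : ContDiff ℝ 2 F) (p : ℝ × Vec m) :
    cauchyRiemann (pd₀ F) p = pd₀ (cauchyRiemann F) p := by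
  have hd (v : ℝ × Vec m) : DifferentiableAt ℝ (fun q => lineDeriv ℝ F q v) p :=
    (contDiff_lineDeriv hF (k := 1) (by norm_num) v).differentiable_one p
  have hsum : DifferentiableAt ℝ (fun q => ∑ j : Fin m, vec (basisVec j) * pd j F q) p :=
    DifferentiableAt.fun_sum fun j _ =>
      (clMul m (vec (basisVec j))).differentiableAt.comp p (hd (0, basisVec j))
  have hadd : pd₀ (cauchyRiemann F) p =
      pd₀ (pd₀ F) p + pd₀ (fun q => ∑ j : Fin m, vec (basisVec j) * pd j F q) p :=
    lineDeriv_add (hd (1, 0)) hsum _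
  have hcomm (j : Fin m) : pd j (pd₀ F) p = pd₀ (pd j F) p := lineDeriv_comm hF _ _ p
  simp only [hadd, cauchyRiemann, hcomm]
  exact congrArg _ (lineDeriv_sum_basisVec_mul (fun j => hd (0, basisVec j)) _).symm

theorem iterate_dirac_slice (hF : ContDiff ℝ ∞ F) (hCR : ∀ p, cauchyRiemann F p = 0) (t : ℝ)
    (n : ℕ) : dirac^[n] (fun x => F (t, x)) = fun x => (-1 : ℝ) ^ n • pd₀^[n] F (t, x) := by
  induction n generalizing F with
  | zero => simp
  | succ n ih =>
    have hdirac : (dirac fun x => F (t, x)) = fun x => (-1 : ℝ) • pd₀ F (t, x) := by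
      funext x
      rw [neg_one_smul, eq_neg_iff_add_eq_zero, add_comm, ← cauchyRiemann_eq_pd₀_add_dirac, hCR]
    have hCR' (p : ℝ × Vec m) : cauchyRiemann (pd₀ F) p = 0 := by
      rw [cauchyRiemann_pd₀ (contDiff_infty.1 hF 2), funext hCR]
      simp [pd₀, lineDeriv]
    rw [Function.iterate_succ_apply, hdirac, iterate_dirac_const_smul,
      ih (contDiff_pd₀ hF) hCR']
    simp only [smul_smul, pow_succ', Function.iterate_succ_apply]

theorem ckTerm_const_smul (c : ℝ) (g : Vec m → Cl m) (p : ℝ × Vec m) (n : ℕ) :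
    ckTerm (fun x => c • g x) p n = c • ckTerm g p n := by
  rw [ckTerm, iterate_dirac_const_smul, smul_comm, ckTerm]

theorem ckTerm_slice_zero (hF : ContDiff ℝ ∞ F) (hCR : ∀ p, cauchyRiemann F p = 0)
    (p : ℝ × Vec m) (n : ℕ) :
    ckTerm (fun x => F (0, x)) p n = (p.1 ^ n / n ! : ℝ) • pd₀^[n] F (0, p.2) := by
  have hsign : (-p.1) ^ n * (-1) ^ n = p.1 ^ n := by rw [← mul_pow, mul_neg_one, neg_neg]
  rw [ckTerm, iterate_dirac_slice hF hCR, smul_smul, ← hsign]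
  congr 1
  ring

end CauchyRiemann

section Axial

variable {m k n N : ℕ} {P : Vec m → Cl m} {A B : ℝ × ℝ → ℝ}

/-- The function `A(x₀, r²) P(x) + B(x₀, r²) x P(x)` of axial type, where `r = |x|`. Taking `r²`
rather than `r` as an argument makes it as smooth as `A`, `B` and `P`. -/
def axial (P : Vec m → Cl m) (A B : ℝ × ℝ → ℝ) (p : ℝ × Vec m) : Cl m :=
  A (p.1, ‖p.2‖ ^ 2) • P p.2 + B (p.1, ‖p.2‖ ^ 2) • (vec p.2 * P p.2)

theorem contDiff_axial (hP : ContDiff ℝ ∞ P) (hA : ContDiff ℝ ∞ A) (hB : ContDiff ℝ ∞ B) :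
    ContDiff ℝ ∞ (axial P A B) := by
  have hs : ContDiff ℝ ∞ fun p : ℝ × Vec m => (p.1, ‖p.2‖ ^ 2) :=
    contDiff_fst.prodMk (contDiff_snd.norm_sq ℝ)
  exact ((hA.comp hs).smul (hP.comp contDiff_snd)).add
    ((hB.comp hs).smul ((contDiff_vec_mul hP).comp contDiff_snd))

theorem pd₀_axial (P : Vec m → Cl m) (hA : Differentiable ℝ A) (hB : Differentiable ℝ B) :
    pd₀ (axial P A B) = axial P (partialFst A) (partialFst B) := by
  funext ⟨t, x⟩
  have hd : HasDerivAt (fun t => axial P A B (t, x))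
      (axial P (partialFst A) (partialFst B) (t, x)) t :=
    ((hasDerivAt_partialFst hA t (‖x‖ ^ 2)).smul_const (P x)).fun_add
      ((hasDerivAt_partialFst hB t (‖x‖ ^ 2)).smul_const (vec x * P x))
  rw [← hd.deriv, ← zero_add t, ← deriv_comp_add_const]
  simp [pd₀, lineDeriv, add_comm]

theorem iterate_pd₀_axial (P : Vec m → Cl m) (hA : ContDiff ℝ ∞ A) (hB : ContDiff ℝ ∞ B)
    (n : ℕ) : pd₀^[n] (axial P A B) = axial P (partialFst^[n] A) (partialFst^[n] B) := by
  induction n generalizing A B with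
  | zero => rfl
  | succ n ih =>
    rw [Function.iterate_succ_apply, pd₀_axial P (hA.differentiable (by simp))
      (hB.differentiable (by simp)), ih (contDiff_partialFst hA) (contDiff_partialFst hB)]
    rfl

theorem dirac_axial (hP : IsHomogeneousPolynomial k P) (hmon : ∀ x, dirac P x = 0)
    (hA : Differentiable ℝ A) (hB : Differentiable ℝ B) (t : ℝ) :
    dirac (fun x => axial P A B (t, x)) = fun x =>
      axial P (fun q => -1 * ((m + 2 * k) * B q + 2 * q.2 * partialSnd B q))
        (fun q => 2 * partialSnd A q) (t, x) := by
  funext x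
  have hPd : Differentiable ℝ P := hP.contDiff.differentiable (by simp)
  have hvd : Differentiable ℝ fun y => vec y * P y :=
    (contDiff_vec_mul hP.contDiff).differentiable (by simp)
  have hvec : dirac (fun y => vec y * P y) x = -(m + 2 * k : ℝ) • P x := by
    rw [dirac_vec_mul (hPd x), hmon,
      fderiv_self_of_map_smul (hPd x) fun t => hP.map_smul t x, mul_zero]
    module
  have hslice {C : ℝ × ℝ → ℝ} (hC : Differentiable ℝ C) {f : Vec m → Cl m}
      (hf : Differentiable ℝ f) : Differentiable ℝ fun y => C (t, ‖y‖ ^ 2) • f y := fun y =>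
    (hC.comp (differentiable_const t |>.prodMk (differentiable_id.norm_sq ℝ))).smul hf y
  simp only [axial]
  rw [dirac_add (hslice hA hPd x) (hslice hB hvd x),
    dirac_radial_smul (hasDerivAt_partialSnd hA t _) (hPd x),
    dirac_radial_smul (hasDerivAt_partialSnd hB t _) (hvd x), hvec, hmon, vec_mul_vec_mul]
  module

theorem isMonogenicExt_axial (hP : IsHomogeneousPolynomial k P) (hmon : ∀ x, dirac P x = 0)
    (hN : m + 2 * k = 2 * N + 1) (h : IsVekuaPair N A B) : IsMonogenicExt (axial P A B) := by
  have hA : Differentiable ℝ A := h.contDiff_left.differentiable (by simp)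
  have hB : Differentiable ℝ B := h.contDiff_right.differentiable (by simp)
  have hN' : (m + 2 * k : ℝ) = 2 * N + 1 := mod_cast hN
  refine ⟨(contDiff_axial hP.contDiff h.contDiff_left h.contDiff_right).of_le (by simp),
    fun ⟨t, x⟩ => ?_⟩
  rw [cauchyRiemann_eq_pd₀_add_dirac, pd₀_axial P hA hB, dirac_axial hP hmon hA hB]
  simp only [axial, h.partialFst_left, h.partialFst_right, hN']
  module

theorem laplace_axial (hP : IsHomogeneousPolynomial k P) (hmon : ∀ x, dirac P x = 0)
    (hN : m + 2 * k = 2 * N + 1) (h : IsVekuaPair n A B) :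
    laplace (axial P A B) =
      fun p => (4 * (N - n) : ℝ) • axial P (partialSnd A) (partialSnd B) p := by
  have hA : Differentiable ℝ A := h.contDiff_left.differentiable (by simp)
  have hB : Differentiable ℝ B := h.contDiff_right.differentiable (by simp)
  have hA₁ := (contDiff_partialFst h.contDiff_left).differentiable (by simp)
  have hB₁ := (contDiff_partialFst h.contDiff_right).differentiable (by simp)
  have hA₂ := (contDiff_partialSnd h.contDiff_left).differentiable (by simp)
  have hB₂ := (contDiff_partialSnd h.contDiff_right).differentiable (by simp)
  have hN' : (m + 2 * k : ℝ) = 2 * N + 1 := mod_cast hN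
  funext ⟨t, x⟩
  rw [laplace_eq_pd₀_pd₀_sub_dirac_dirac
      (contDiff_infty.1 (contDiff_axial hP.contDiff h.contDiff_left h.contDiff_right) 2),
    pd₀_axial P hA hB, pd₀_axial P hA₁ hB₁, dirac_axial hP hmon hA hB,
    dirac_axial hP hmon (by fun_prop) (hA₂.const_mul 2)]
  simp only [axial, h.partialFst_partialFst_left, h.partialFst_partialFst_right, hN',
    partialSnd_const_mul, partialSnd_vekuaLeft h.contDiff_right]
  module

theorem iterate_laplace_axial (hP : IsHomogeneousPolynomial k P) (hmon : ∀ x, dirac P x = 0)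
    (hN : m + 2 * k = 2 * N + 1) (h : IsVekuaPair 0 A B) (j : ℕ) :
    laplace^[j] (axial P A B) = fun p =>
      (4 ^ j * N.descFactorial j : ℝ) • axial P (partialSnd^[j] A) (partialSnd^[j] B) p := by
  induction j with
  | zero => simp
  | succ j ih =>
    have hdesc : (N.descFactorial (j + 1) : ℝ) = (N - j) * N.descFactorial j := by
      rcases le_or_gt j N with hj | hj
      · rw [Nat.descFactorial_succ, Nat.cast_mul, Nat.cast_sub hj]
      · simp [Nat.descFactorial_of_lt hj, hj.le]
    rw [Function.iterate_succ_apply', ih, laplace_const_smul,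
      laplace_axial hP hmon hN (h.iterate_partialSnd j)]
    funext p
    rw [smul_smul, hdesc, Function.iterate_succ_apply', Function.iterate_succ_apply']
    congr 1
    push_cast
    ring

end Axial

section Fueter

variable {m k N : ℕ} {P : Vec m → Cl m} {A B : ℂ × ℂ → ℂ}

theorem hasSum_ckTerm_axial (hP : IsHomogeneousPolynomial k P) (hmon : ∀ x, dirac P x = 0)
    (hN : m + 2 * k = 2 * N + 1) (h : IsVekuaPair N A B) (p : ℝ × Vec m) :
    HasSum (ckTerm (fun x => axial P (reRestrict A) (reRestrict B) (0, x)) p)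
      (axial P (reRestrict A) (reRestrict B) p) := by
  have hA := contDiff_reRestrict h.contDiff_left
  have hB := contDiff_reRestrict h.contDiff_right
  have hCR := (isMonogenicExt_axial hP hmon hN h.reRestrict).2
  refine (((hasSum_iterate_partialFst_reRestrict h.contDiff_left p.1 _).smul_const (P p.2)).add
    ((hasSum_iterate_partialFst_reRestrict h.contDiff_right p.1 _).smul_const
      (vec p.2 * P p.2))).congr_fun fun n => ?_
  rw [ckTerm_slice_zero (contDiff_axial hP.contDiff hA hB) hCR, iterate_pd₀_axial P hA hB, axial,
    smul_add, smul_smul, smul_smul]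

theorem fueterBase_eq_axial {h : ℂ → ℂ} (hAB : IsStemPair h A B)
    (hconj : ∀ z, h (starRingEnd ℂ z) = starRingEnd ℂ (h z)) (P : Vec m → Cl m) :
    fueterBase h P = axial P (reRestrict A) (reRestrict B) := by
  funext ⟨t, x⟩
  set ζ : ℂ := ⟨t, ‖x‖⟩
  have hζ : (t : ℂ) + Complex.I * (‖x‖ : ℂ) = ζ := by
    rw [mul_comm]
    exact (Complex.mk_eq_add_mul_I t ‖x‖).symm
  have hζ' : (t : ℂ) + Complex.I * -(‖x‖ : ℂ) = starRingEnd ℂ ζ := by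
    rw [← hζ]
    simp
  have hplus := hAB.add_mul_eq t ‖x‖
  have hminus := hAB.add_mul_eq t (-‖x‖)
  rw [hζ] at hplus
  rw [hζ', hconj, neg_sq] at hminus
  have hA : A (t, (‖x‖ ^ 2 : ℝ)) = (h ζ).re := by
    rw [Complex.re_eq_add_conj]
    push_cast
    linear_combination (hplus + hminus) / 2
  have hB : (‖x‖ : ℂ) * B (t, (‖x‖ ^ 2 : ℝ)) = (h ζ).im := by
    rw [Complex.im_eq_sub_conj, eq_div_iff (by simp)]
    push_cast
    linear_combination hplus - hminus
  have hre : (h ζ).re = reRestrict A (t, ‖x‖ ^ 2) := by rw [reRestrict, hA, Complex.ofReal_re]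
  have him : (h ζ).im = reRestrict B (t, ‖x‖ ^ 2) * ‖x‖ := by
    rw [reRestrict, mul_comm, ← Complex.re_ofReal_mul, hB, Complex.ofReal_re]
  rw [fueterBase, axial, hre, him, add_mul, Algebra.algebraMap_eq_smul_one, smul_mul_assoc, one_mul,
    mul_smul, norm_smul_omega, smul_mul_assoc]

theorem Ft_eq_axial (hP : IsHomogeneousPolynomial k P) (hmon : ∀ x, dirac P x = 0)
    {h : ℂ → ℂ} (hAB : IsStemPair h A B)
    (hconj : ∀ z, h (starRingEnd ℂ z) = starRingEnd ℂ (h z)) (hN : m + 2 * k = 2 * N + 1) :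
    Ft k h P = fun p => (4 ^ N * N ! : ℝ) •
      axial P (partialSnd^[N] (reRestrict A)) (partialSnd^[N] (reRestrict B)) p := by
  have hN' : k + (m - 1) / 2 = N := by omega
  rw [Ft, hN', fueterBase_eq_axial hAB hconj,
    iterate_laplace_axial hP hmon hN hAB.isVekuaPair.reRestrict, Nat.descFactorial_self]

theorem isMonogenicExt_Ft (hP : IsHomogeneousPolynomial k P) (hmon : ∀ x, dirac P x = 0)
    {h : ℂ → ℂ} (hAB : IsStemPair h A B)
    (hconj : ∀ z, h (starRingEnd ℂ z) = starRingEnd ℂ (h z)) (hN : m + 2 * k = 2 * N + 1) :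
    IsMonogenicExt (Ft k h P) := by
  have hpair := hAB.isVekuaPair.reRestrict.iterate_partialSnd N
  rw [zero_add] at hpair
  rw [Ft_eq_axial hP hmon hAB hconj hN]
  exact (isMonogenicExt_axial hP hmon hN hpair).const_smul _

theorem hasSum_ckTerm_Ft (hP : IsHomogeneousPolynomial k P) (hmon : ∀ x, dirac P x = 0)
    {h : ℂ → ℂ} (hAB : IsStemPair h A B)
    (hconj : ∀ z, h (starRingEnd ℂ z) = starRingEnd ℂ (h z)) (hN : m + 2 * k = 2 * N + 1)
    (p : ℝ × Vec m) : HasSum (ckTerm (fun x => Ft k h P (0, x)) p) (Ft k h P p) := by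
  have hpair := hAB.isVekuaPair.iterate_partialSnd N
  rw [zero_add] at hpair
  rw [Ft_eq_axial hP hmon hAB hconj hN,
    iterate_partialSnd_reRestrict hAB.contDiff_left,
    iterate_partialSnd_reRestrict hAB.contDiff_right]
  exact ((hasSum_ckTerm_axial hP hmon hN hpair p).const_smul _).congr_fun
    (ckTerm_const_smul _ _ p)

end Fueter

section GaussianStem

/-- The entire function `cos √s`, given by its power series. -/
def cosSqrt (s : ℂ) : ℂ := ∑' n : ℕ, (-1) ^ n * s ^ n / ((2 * n)! : ℂ)

/-- The entire function `sin √s / √s`, expressed through the derivative of `cos √s`. -/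
def sincSqrt (s : ℂ) : ℂ := -2 * deriv cosSqrt s

theorem cosSqrt_sq (z : ℂ) : cosSqrt (z ^ 2) = Complex.cos z := by
  rw [← (Complex.hasSum_cos z).tsum_eq, cosSqrt]
  simp only [pow_mul]

theorem differentiable_cosSqrt : Differentiable ℂ cosSqrt := by
  intro z
  have hbound (n : ℕ) (w : ℂ) (hw : w ∈ Metric.ball (0 : ℂ) (‖z‖ + 1)) :
      ‖(-1) ^ n * w ^ n / ((2 * n)! : ℂ)‖ ≤ (‖z‖ + 1) ^ n / n ! := by
    have hw' : ‖w‖ ≤ ‖z‖ + 1 := (mem_ball_zero_iff.1 hw).le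
    have hfac : (n ! : ℝ) ≤ ((2 * n)! : ℕ) := mod_cast Nat.factorial_le (by lia)
    simp only [norm_div, norm_mul, norm_pow, norm_neg, norm_one, one_pow, one_mul,
      Complex.norm_natCast]
    gcongr
  exact (Complex.differentiableOn_tsum_of_summable_norm
    (Real.summable_pow_div_factorial (‖z‖ + 1)) (fun n => by fun_prop) Metric.isOpen_ball
    hbound).differentiableAt (Metric.isOpen_ball.mem_nhds (by simp))

theorem mul_sincSqrt_sq (z : ℂ) : z * sincSqrt (z ^ 2) = Complex.sin z := by
  have hchain := (differentiable_cosSqrt (z ^ 2)).hasDerivAt.comp z (hasDerivAt_pow 2 z)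
  have hcos := hchain.unique
    ((Complex.hasDerivAt_cos z).congr_of_eventuallyEq (.of_forall cosSqrt_sq))
  simp only [Nat.cast_ofNat, Nat.add_one_sub_one, pow_one] at hcos
  rw [sincSqrt]
  linear_combination -hcos

/-- The entire function `cos (2 z √s)` of `(z, s)`. -/
def cosFactor (p : ℂ × ℂ) : ℂ := cosSqrt (4 * p.1 ^ 2 * p.2)

/-- The entire function `sin (2 z √s) / √s` of `(z, s)`. -/
def sincFactor (p : ℂ × ℂ) : ℂ := 2 * p.1 * sincSqrt (4 * p.1 ^ 2 * p.2)

theorem contDiff_cosFactor : ContDiff ℂ ∞ cosFactor :=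
  differentiable_cosSqrt.contDiff.comp (by fun_prop)

theorem contDiff_sincFactor : ContDiff ℂ ∞ sincFactor := by
  have hsinc : ContDiff ℂ ∞ sincSqrt :=
    contDiff_const.mul (contDiff_infty_iff_deriv.1 differentiable_cosSqrt.contDiff).2
  exact (by fun_prop : ContDiff ℂ ∞ fun p : ℂ × ℂ => 2 * p.1).mul (hsinc.comp (by fun_prop))

theorem cosFactor_sq (z w : ℂ) : cosFactor (z, w ^ 2) = Complex.cos (2 * z * w) := by
  rw [← cosSqrt_sq, cosFactor]
  ring_nf

theorem mul_sincFactor_sq (z w : ℂ) : w * sincFactor (z, w ^ 2) = Complex.sin (2 * z * w) := by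
  rw [← mul_sincSqrt_sq, sincFactor]
  ring_nf

/-- Multiplication of a function of `(z, s)` by `exp (z ^ 2 - s)`. -/
def gaussMul (C : ℂ × ℂ → ℂ) (p : ℂ × ℂ) : ℂ := Complex.exp (p.1 ^ 2 - p.2) * C p

theorem contDiff_gaussMul {C : ℂ × ℂ → ℂ} (hC : ContDiff ℂ ∞ C) : ContDiff ℂ ∞ (gaussMul C) :=
  (by fun_prop : ContDiff ℂ ∞ fun p : ℂ × ℂ => Complex.exp (p.1 ^ 2 - p.2)).mul hC

theorem isStemPair_exp_sq :
    IsStemPair (fun z => Complex.exp (z ^ 2)) (gaussMul cosFactor) (gaussMul sincFactor) where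
  contDiff_left := contDiff_gaussMul contDiff_cosFactor
  contDiff_right := contDiff_gaussMul contDiff_sincFactor
  add_mul_eq z w := by
    have hsq : (z + Complex.I * w) ^ 2 = z ^ 2 - w ^ 2 + 2 * z * w * Complex.I := by
      linear_combination w ^ 2 * Complex.I_sq
    rw [hsq, Complex.exp_add, Complex.exp_mul_I, ← cosFactor_sq, ← mul_sincFactor_sq, gaussMul,
      gaussMul]
    ring

theorem reRestrict_gaussMul (C : ℂ × ℂ → ℂ) (t s : ℝ) :
    reRestrict (gaussMul C) (t, s) = Real.exp (t ^ 2 - s) * reRestrict C (t, s) := by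
  rw [reRestrict, gaussMul, reRestrict, ← Complex.re_ofReal_mul]
  push_cast
  rfl

theorem iteratedDeriv_exp_const_sub_mul (c : ℝ) {f : ℝ → ℝ} (hf : ContDiff ℝ ∞ f) (n : ℕ)
    (s : ℝ) : iteratedDeriv n (fun s => Real.exp (c - s) * f s) s = (-1) ^ n *
      (Real.exp (c - s) * ∑ j ∈ Finset.range (n + 1), n.choose j * (-1) ^ j *
        iteratedDeriv j f s) := by
  have hexp (i : ℕ) : iteratedDeriv i (fun s => Real.exp (c - s)) s =
      (-1) ^ i * Real.exp (c - s) := by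
    simpa [iteratedDeriv_eq_iterate, Real.iter_deriv_exp] using
      congrFun (iteratedDeriv_comp_const_sub i Real.exp c) s
  simp only [mul_comm _ (f _)]
  rw [iteratedDeriv_fun_mul (contDiff_infty.1 hf n).contDiffAt (by fun_prop), Finset.mul_sum,
    Finset.mul_sum]
  refine Finset.sum_congr rfl fun j hj => ?_
  rw [hexp, pow_sub₀ _ (by norm_num) (Finset.mem_range_succ_iff.1 hj), ← inv_pow, inv_neg_one]
  ring

theorem iterate_partialSnd_reRestrict_gaussMul {C : ℂ × ℂ → ℂ} (hC : ContDiff ℂ ∞ C) (n : ℕ)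
    (t s : ℝ) : partialSnd^[n] (reRestrict (gaussMul C)) (t, s) = (-1) ^ n *
      (Real.exp (t ^ 2 - s) * ∑ j ∈ Finset.range (n + 1), n.choose j * (-1) ^ j *
        iteratedDeriv j (fun s => reRestrict C (t, s)) s) := by
  simp only [iterate_partialSnd, reRestrict_gaussMul]
  exact iteratedDeriv_exp_const_sub_mul _
    ((contDiff_reRestrict hC).comp (contDiff_const.prodMk contDiff_id)) n s

end GaussianStem

section ClosedForm

variable {f F : ℝ → ℝ} {r : ℝ}

theorem hasDerivAt_iteratedDeriv_sq (hF : ContDiff ℝ ∞ F) (j : ℕ) (r : ℝ) :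
    HasDerivAt (fun r => iteratedDeriv j F (r ^ 2))
      (iteratedDeriv (j + 1) F (r ^ 2) * (2 * r)) r := by
  have hsq : HasDerivAt (fun r : ℝ => r ^ 2) (2 * r) r := by simpa using hasDerivAt_pow 2 r
  have hj : DifferentiableAt ℝ (iteratedDeriv j F) (r ^ 2) :=
    hF.differentiable_iteratedDeriv j (mod_cast WithTop.coe_lt_top _) _
  rw [iteratedDeriv_succ]
  exact HasDerivAt.comp (h := fun r : ℝ => r ^ 2) r hj.hasDerivAt hsq

theorem lowerD_eq_iteratedDeriv (hF : ContDiff ℝ ∞ F) (hf : ∀ r, f r = F (r ^ 2)) (j : ℕ)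
    (hr : r ≠ 0) : lowerD j f r = 2 ^ j * iteratedDeriv j F (r ^ 2) := by
  induction j generalizing r with
  | zero => simpa [lowerD] using hf r
  | succ j ih =>
    have hnear : lowerD j f =ᶠ[𝓝 r] fun r => 2 ^ j * iteratedDeriv j F (r ^ 2) := by
      filter_upwards [isOpen_ne.mem_nhds hr] with r hr using ih hr
    have hsucc : lowerD (j + 1) f r = r⁻¹ * deriv (lowerD j f) r := by
      simp only [lowerD, Function.iterate_succ_apply']
    rw [hsucc, hnear.deriv_eq, ((hasDerivAt_iteratedDeriv_sq hF j r).const_mul (2 ^ j)).deriv]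
    field_simp
    ring

theorem upperD_eq_iteratedDeriv (hF : ContDiff ℝ ∞ F) (hf : ∀ r, f r = r * F (r ^ 2)) (j : ℕ)
    (hr : r ≠ 0) : upperD j f r = r * (2 ^ j * iteratedDeriv j F (r ^ 2)) := by
  induction j generalizing r with
  | zero => simpa [upperD] using hf r
  | succ j ih =>
    have hnear : (fun r => r⁻¹ * upperD j f r) =ᶠ[𝓝 r]
        fun r => 2 ^ j * iteratedDeriv j F (r ^ 2) := by
      filter_upwards [isOpen_ne.mem_nhds hr] with r hr
      rw [ih hr, inv_mul_cancel_left₀ hr]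
    have hsucc : upperD (j + 1) f r = deriv (fun r => r⁻¹ * upperD j f r) r := by
      simp only [upperD, Function.iterate_succ_apply']
    rw [hsucc, hnear.deriv_eq, ((hasDerivAt_iteratedDeriv_sq hF j r).const_mul (2 ^ j)).deriv]
    ring

theorem neg_two_zpow_mul (j : ℕ) (a : ℝ) : (-2 : ℝ) ^ (-(j : ℤ)) * (2 ^ j * a) = (-1) ^ j * a := by
  rw [zpow_neg, zpow_natCast, neg_pow, mul_inv, ← inv_pow, inv_neg_one]
  field_simp

theorem cosPart_eq_sum_iteratedDeriv (N : ℕ) (t : ℝ) (hr : r ≠ 0) :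
    cosPart N t r = ∑ j ∈ Finset.range (N + 1), N.choose j * (-1) ^ j *
      iteratedDeriv j (fun s => reRestrict cosFactor (t, s)) (r ^ 2) := by
  have hcos (r : ℝ) : Real.cos (2 * t * r) = reRestrict cosFactor (t, r ^ 2) := by
    rw [reRestrict, Complex.ofReal_pow, cosFactor_sq]
    exact_mod_cast (Complex.ofReal_re _).symm
  have hsmooth : ContDiff ℝ ∞ fun s => reRestrict cosFactor (t, s) :=
    (contDiff_reRestrict contDiff_cosFactor).comp (contDiff_const.prodMk contDiff_id)
  refine Finset.sum_congr rfl fun j _ => ?_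
  rw [lowerD_eq_iteratedDeriv hsmooth hcos j hr, mul_assoc, neg_two_zpow_mul, mul_assoc]

theorem sinPart_eq_sum_iteratedDeriv (N : ℕ) (t : ℝ) (hr : r ≠ 0) :
    sinPart N t r = r * ∑ j ∈ Finset.range (N + 1), N.choose j * (-1) ^ j *
      iteratedDeriv j (fun s => reRestrict sincFactor (t, s)) (r ^ 2) := by
  have hsin (r : ℝ) : Real.sin (2 * t * r) = r * reRestrict sincFactor (t, r ^ 2) := by
    rw [reRestrict, ← Complex.re_ofReal_mul, Complex.ofReal_pow, mul_sincFactor_sq]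
    exact_mod_cast (Complex.ofReal_re _).symm
  have hsmooth : ContDiff ℝ ∞ fun s => reRestrict sincFactor (t, s) :=
    (contDiff_reRestrict contDiff_sincFactor).comp (contDiff_const.prodMk contDiff_id)
  rw [sinPart, Finset.mul_sum]
  refine Finset.sum_congr rfl fun j _ => ?_
  rw [upperD_eq_iteratedDeriv hsmooth hsin j hr, mul_assoc, mul_left_comm _ r, neg_two_zpow_mul]
  ring

end ClosedForm

section GaussianFueter

variable {m k N : ℕ} {P : Vec m → Cl m}

theorem exp_conj_sq (z : ℂ) :
    Complex.exp (starRingEnd ℂ z ^ 2) = starRingEnd ℂ (Complex.exp (z ^ 2)) := by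
  rw [← map_pow, Complex.exp_conj]

theorem four_pow_mul_factorial_mul_neg_one_pow (N : ℕ) :
    (4 ^ N * N ! : ℝ) * (-1) ^ N = (-2) ^ N * ((2 * N)‼ : ℕ) := by
  rw [Nat.doubleFactorial_two_mul, neg_pow 2, show (4 : ℝ) = 2 * 2 by norm_num, mul_pow]
  push_cast
  ring

theorem neg_two_pow_mul_doubleFactorial_ne_zero (N : ℕ) : ((-2) ^ N * (2 * N)‼ : ℝ) ≠ 0 :=
  mul_ne_zero (by simp) (mod_cast (Nat.doubleFactorial_pos _).ne')

theorem Ft_exp_sq_eq_smul_closedForm (hP : IsHomogeneousPolynomial k P)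
    (hmon : ∀ x, dirac P x = 0) (hN : m + 2 * k = 2 * N + 1) {p : ℝ × Vec m} (hp : p.2 ≠ 0) :
    Ft k (fun z => Complex.exp (z ^ 2)) P p =
      ((-2 : ℝ) ^ N * (2 * N)‼) • closedForm N P p := by
  have hr : ‖p.2‖ ≠ 0 := norm_ne_zero_iff.2 hp
  rw [Ft_eq_axial hP hmon isStemPair_exp_sq exp_conj_sq hN, closedForm,
    cosPart_eq_sum_iteratedDeriv N p.1 hr, sinPart_eq_sum_iteratedDeriv N p.1 hr,
    ← four_pow_mul_factorial_mul_neg_one_pow]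
  simp only [axial, iterate_partialSnd_reRestrict_gaussMul contDiff_cosFactor,
    iterate_partialSnd_reRestrict_gaussMul contDiff_sincFactor]
  rw [← norm_smul_omega, Algebra.algebraMap_eq_smul_one, add_mul, smul_one_mul,
    smul_mul_assoc, smul_mul_assoc]
  module

theorem Ft_exp_sq_zero (hP : IsHomogeneousPolynomial k P) (hmon : ∀ x, dirac P x = 0)
    (hN : m + 2 * k = 2 * N + 1) (x : Vec m) :
    Ft k (fun z => Complex.exp (z ^ 2)) P (0, x) =
      ((-2 : ℝ) ^ N * (2 * N)‼) • Real.exp (-‖x‖ ^ 2) • P x := by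
  have hcos (s : ℝ) : reRestrict cosFactor (0, s) = 1 := by
    simpa [reRestrict, cosFactor] using congrArg Complex.re (cosSqrt_sq 0)
  have hsinc (s : ℝ) : reRestrict sincFactor (0, s) = 0 := by simp [reRestrict, sincFactor]
  rw [Ft_eq_axial hP hmon isStemPair_exp_sq exp_conj_sq hN,
    ← four_pow_mul_factorial_mul_neg_one_pow]
  simp [axial, iterate_partialSnd_reRestrict_gaussMul contDiff_cosFactor,
    iterate_partialSnd_reRestrict_gaussMul contDiff_sincFactor, hcos, hsinc, iteratedDeriv_const,
    smul_smul, mul_assoc]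

theorem hasSum_ckTerm_exp_neg_norm_sq_smul (hP : IsHomogeneousPolynomial k P)
    (hmon : ∀ x, dirac P x = 0) (hN : m + 2 * k = 2 * N + 1) (p : ℝ × Vec m) :
    HasSum (ckTerm (fun x => Real.exp (-‖x‖ ^ 2) • P x) p)
      (((-2 : ℝ) ^ N * (2 * N)‼)⁻¹ • Ft k (fun z => Complex.exp (z ^ 2)) P p) := by
  have hFt : (fun x => Real.exp (-‖x‖ ^ 2) • P x) = fun x =>
      ((-2 : ℝ) ^ N * (2 * N)‼)⁻¹ • Ft k (fun z => Complex.exp (z ^ 2)) P (0, x) := by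
    funext x
    rw [Ft_exp_sq_zero hP hmon hN, inv_smul_smul₀ (neg_two_pow_mul_doubleFactorial_ne_zero N)]
  rw [hFt]
  exact ((hasSum_ckTerm_Ft hP hmon isStemPair_exp_sq exp_conj_sq hN p).const_smul _).congr_fun
    (ckTerm_const_smul _ _ p)

end GaussianFueter

end CliffordAnalysis

end

open CliffordAnalysis in
theorem mainTheorem1 (m k : ℕ) (hm : Odd m) (P : Vec m → Cl m)
    (hP : IsHomogeneousPolynomial k P) (hPmono : IsMonogenic P)
    (g : Vec m → Cl m) (hg : g = fun x => Real.exp (-‖x‖ ^ 2) • P x) :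
    -- the Cauchy–Kowalevski series converges everywhere to a monogenic extension of `g`
    (∀ p : ℝ × Vec m, Summable (ckTerm g p)) ∧
    IsMonogenicExt (CK g) ∧
    (∀ x : Vec m, CK g (0, x) = g x) ∧
    -- first equality
    (∀ p : ℝ × Vec m, CK g p =
      ((-2 : ℝ) ^ (k + (m - 1) / 2) * ((2 * k + m - 1)‼ : ℝ))⁻¹ •
        Ft k (fun z => Complex.exp (z ^ 2)) P p) ∧
    -- second equality; at `x = 0` the closed form is read as a limit
    (∀ p : ℝ × Vec m, p.2 ≠ 0 → CK g p = closedForm (k + (m - 1) / 2) P p) ∧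
    (∀ x₀ : ℝ, Filter.Tendsto (closedForm (k + (m - 1) / 2) P)
      (𝓝[{p : ℝ × Vec m | p.2 ≠ 0}] (x₀, 0)) (𝓝 (CK g (x₀, 0)))) ∧
    -- generating function of the Clifford–Hermite polynomials
    (∀ p : ℝ × Vec m, HasSum
      (fun n : ℕ => (Real.exp (-‖p.2‖ ^ 2) * (p.1 ^ n / (n ! : ℝ))) • cliffordHermite n P p.2)
      (CK g p)) := by
  set N := k + (m - 1) / 2
  have hN : m + 2 * k = 2 * N + 1 := by
    obtain ⟨l, rfl⟩ := hm
    omega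
  have hmon := hPmono.2
  have hc := neg_two_pow_mul_doubleFactorial_ne_zero N
  rw [show 2 * k + m - 1 = 2 * N by omega]
  have hsum (p : ℝ × Vec m) : HasSum (ckTerm g p)
      (((-2 : ℝ) ^ N * (2 * N)‼)⁻¹ • Ft k (fun z => Complex.exp (z ^ 2)) P p) :=
    hg ▸ hasSum_ckTerm_exp_neg_norm_sq_smul hP hmon hN p
  have hCK (p : ℝ × Vec m) : CK g p = _ := (hsum p).tsum_eq
  have hmono : IsMonogenicExt (CK g) := by
    rw [funext hCK]
    exact (isMonogenicExt_Ft hP hmon isStemPair_exp_sq exp_conj_sq hN).const_smul _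
  have hclosed (p : ℝ × Vec m) (hp : p.2 ≠ 0) : CK g p = closedForm N P p := by
    rw [hCK, Ft_exp_sq_eq_smul_closedForm hP hmon hN hp, inv_smul_smul₀ hc]
  refine ⟨fun p => (hsum p).summable, hmono, fun x => ?_, hCK, hclosed, fun x₀ => ?_, fun p => ?_⟩
  · rw [hCK, Ft_exp_sq_zero hP hmon hN, inv_smul_smul₀ hc, hg]
  · exact (hmono.1.continuous.continuousAt.mono_left nhdsWithin_le_nhds).congr'
      (eventually_nhdsWithin_of_forall hclosed)
  · rw [hCK]
    refine (hsum p).congr_fun fun n => ?_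
    rw [hg, ckTerm_exp_neg_norm_sq_smul hP.contDiff]
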